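/- Let $n\ge 1$ and let $R$ be a finite commutative local ring whose residue field has $q$ elements. A polynomial $p\in R[x_1]$ is a permutation polynomial on $R$ if $a\mapsto p(a)$ is a bijection of $R$, and a polynomial $g\in R[x_1,\ldots,x_k]$ is unit-valued if $g(a)\in R^\times$ for all $a\in R^k$. Let $\mathcal{MT}_n$ be the monoid, under composition, of all vector-polynomials $$\vec f=\bigl(f_1(x_1),\; f_2(x_1)+x_2g_2(x_1),\;\ldots,\; f_n(x_1,\ldots,x_{n-1})+x_n g_n(x_1,\ldots,x_{n-1})\bigr),$$ where $f_1\in R[x_1]$ is a permutation polynomial on $R$ and, for $i=2,\ldots,n$, $f_i,g_i\in R[x_1,\ldots,x_{i-1}]$ with $g_i$ unit-valued (so $\mathcal{MT}_1$ is the monoid of permutation polynomials on $R$). Let $\pi_n(\vec f)\colon R^n\to R^n$ denote the function induced by $\vec f$ via evaluation, and let $\pi_n(\mathcal{MT}_n)$ be the resulting group of permutations of $R^n$ under composition. Then: 1. $\pi_n(\mathcal{MT}_n)$ is solvable if and only if $q\le 4$; 2. $\pi_n(\mathcal{MT}_n)$ is nilpotent if and only if $q=2$; 3. $\pi_n(\mathcal{MT}_n)$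 is abelian if and only if $n=1$ and $R\cong\mathbb{F}_2$. -/

import Mathlib

namespace TriangularMonoid

/-- A one-variable polynomial is a permutation polynomial on `R` if its induced function
permutes the elements of `R`. -/
def IsPermutationPolynomial {R : Type*} [CommRing R] (p : Polynomial R) : Prop :=
  Function.Bijective (fun a : R => p.eval a)

/-- A polynomial in `k` variables is unit-valued if it maps `R ^ k` into the units of `R`. -/
def IsUnitValued {R : Type*} [CommRing R] {k : ℕ} (g : MvPolynomial (Fin k) R) : Prop :=
  ∀ a : Fin k → R, IsUnit (MvPolynomial.eval a g)

/-- Vector-polynomials `(f₁, …, fₙ)` in `n` variables over `R`. -/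
abbrev VecPoly (R : Type*) [CommRing R] (n : ℕ) : Type _ := Fin n → MvPolynomial (Fin n) R

/-- The inclusion of the polynomial ring in the variables preceding the `i`-th one into the
polynomial ring in all `n` variables. -/
noncomputable def incl (R : Type*) [CommRing R] {n : ℕ} (i : Fin n) :
    MvPolynomial (Fin i.val) R →ₐ[R] MvPolynomial (Fin n) R :=
  MvPolynomial.rename (Fin.castLE i.isLt.le)

/-- Composition of vector-polynomials, `(f ∘ g)ᵢ = fᵢ(g₁, …, gₙ)`. -/
noncomputable def comp {R : Type*} [CommRing R] {n : ℕ} (f g : VecPoly R n) : VecPoly R n :=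
  fun i => MvPolynomial.aeval g (f i)

/-- The function on `R ^ n` induced by a vector-polynomial. -/
noncomputable def inducedMap {R : Type*} [CommRing R] {n : ℕ} (f : VecPoly R n) :
    (Fin n → R) → (Fin n → R) :=
  fun a i => MvPolynomial.eval a (f i)

/-- The (underlying set of the) monoid of triangular vector-permutation polynomials: the
vector-polynomials whose first coordinate is a permutation polynomial in the first variable, and
whose `i`-th coordinate, for every later `i`, is of the form `a + xᵢ * b` with `a`, `b` polynomials
in the variables preceding `xᵢ` and `b` unit-valued. (`Fin n` is indexed from `0`.) -/
def MT (R : Type*) [CommRing R] (n : ℕ) : Set (VecPoly R n) :=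
  {f | ∀ i : Fin n,
    (i.val = 0 → ∃ p : Polynomial R, IsPermutationPolynomial p ∧
      f i = Polynomial.aeval (MvPolynomial.X i) p) ∧
    (i.val ≠ 0 → ∃ a b : MvPolynomial (Fin i.val) R, IsUnitValued b ∧
      f i = incl R i a + MvPolynomial.X i * incl R i b)}

section Facts

variable {R : Type*} [CommRing R] {n : ℕ}

theorem eval_aeval {k l : ℕ} (g : Fin k → MvPolynomial (Fin l) R) (a : Fin l → R)
    (p : MvPolynomial (Fin k) R) :
    MvPolynomial.eval a (MvPolynomial.aeval g p) =
      MvPolynomial.eval (fun j => MvPolynomial.eval a (g j)) p := by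
  induction p using MvPolynomial.induction_on with
  | C r => simp
  | add p q hp hq => simp only [map_add, hp, hq]
  | mul_X p j hp => simp only [map_mul, hp, MvPolynomial.aeval_X, MvPolynomial.eval_X]

theorem inducedMap_comp (f g : VecPoly R n) :
    inducedMap (comp f g) = inducedMap f ∘ inducedMap g := by
  funext a i
  exact eval_aeval g a (f i)

theorem eval_incl (a : Fin n → R) (i : Fin n) (p : MvPolynomial (Fin i.val) R) :
    MvPolynomial.eval a (incl R i p) =
      MvPolynomial.eval (fun j => a (Fin.castLE i.isLt.le j)) p := by
  simp [incl, MvPolynomial.eval_rename, Function.comp_def]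

theorem id_mem_MT : (MvPolynomial.X : VecPoly R n) ∈ MT R n := by
  intro i
  refine ⟨fun _ => ⟨Polynomial.X, ?_, by simp⟩, fun _ => ⟨0, 1, fun a => by simp, by simp⟩⟩
  have h : (fun a : R => Polynomial.eval a Polynomial.X) = id := by funext a; simp
  rw [IsPermutationPolynomial, h]
  exact Function.bijective_id

/-- An earlier coordinate of a triangular vector-polynomial involves only earlier variables. -/
theorem exists_incl_eq {g : VecPoly R n} (hg : g ∈ MT R n) (i : Fin n) (j : Fin i.val) :
    ∃ G : MvPolynomial (Fin i.val) R, incl R i G = g (Fin.castLE i.isLt.le j) := by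
  obtain ⟨h0, h1⟩ := hg (Fin.castLE i.isLt.le j)
  by_cases hj : (Fin.castLE i.isLt.le j).val = 0
  · obtain ⟨p, -, hp⟩ := h0 hj
    refine ⟨Polynomial.aeval (MvPolynomial.X j) p, ?_⟩
    rw [hp, ← Polynomial.aeval_algHom_apply]
    simp [incl]
  · obtain ⟨a, b, -, hab⟩ := h1 hj
    refine ⟨incl R j a + MvPolynomial.X j * incl R j b, ?_⟩
    rw [hab]
    simp only [incl, map_add, map_mul, MvPolynomial.rename_X, MvPolynomial.rename_rename]
    rfl

theorem comp_mem_MT {f g : VecPoly R n} (hf : f ∈ MT R n) (hg : g ∈ MT R n) :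
    comp f g ∈ MT R n := by
  intro i
  refine ⟨fun hi => ?_, fun hi => ?_⟩
  · obtain ⟨p, hp, hfi⟩ := (hf i).1 hi
    obtain ⟨q, hq, hgi⟩ := (hg i).1 hi
    refine ⟨p.comp q, ?_, ?_⟩
    · have := Function.Bijective.comp hp hq
      simpa [IsPermutationPolynomial, Function.comp_def, Polynomial.eval_comp] using this
    · simp only [comp, hfi]
      rw [← Polynomial.aeval_algHom_apply, MvPolynomial.aeval_X, hgi, Polynomial.aeval_comp]
  · obtain ⟨a, b, hb, hfi⟩ := (hf i).2 hi
    obtain ⟨c, d, hd, hgi⟩ := (hg i).2 hi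
    choose G hG using exists_incl_eq hg i
    have key : ∀ p : MvPolynomial (Fin i.val) R,
        MvPolynomial.aeval g (incl R i p) = incl R i (MvPolynomial.aeval G p) := by
      intro p
      induction p using MvPolynomial.induction_on with
      | C r => simp [incl]
      | add p q hp hq => simp only [map_add, hp, hq]
      | mul_X p j hp =>
        simp only [map_mul, hp, MvPolynomial.aeval_X, hG]
        simp [incl]
    refine ⟨MvPolynomial.aeval G a + c * MvPolynomial.aeval G b, d * MvPolynomial.aeval G b,
      ?_, ?_⟩
    · intro x
      rw [map_mul, eval_aeval]
      exact (hd x).mul (hb _)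
    · simp only [comp, hfi, map_add, map_mul, key, MvPolynomial.aeval_X, hgi]
      ring

theorem inducedMap_injective {f : VecPoly R n} (hf : f ∈ MT R n) :
    Function.Injective (inducedMap f) := by
  intro a b hab
  have main : ∀ (m : ℕ) (hm : m < n), a ⟨m, hm⟩ = b ⟨m, hm⟩ := by
    intro m
    induction m using Nat.strong_induction_on with
    | _ m ih =>
      intro hm
      have h : MvPolynomial.eval a (f ⟨m, hm⟩) = MvPolynomial.eval b (f ⟨m, hm⟩) :=
        congrFun hab ⟨m, hm⟩
      by_cases h0 : m = 0
      · obtain ⟨p, hp, hfi⟩ := (hf ⟨m, hm⟩).1 h0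
        have ev : ∀ x : Fin n → R, MvPolynomial.eval x (f ⟨m, hm⟩) = p.eval (x ⟨m, hm⟩) := by
          intro x
          rw [hfi, ← MvPolynomial.coe_aeval_eq_eval, RingHom.coe_coe,
            ← Polynomial.aeval_algHom_apply, MvPolynomial.aeval_X, Polynomial.coe_aeval_eq_eval]
        rw [ev, ev] at h
        exact hp.1 h
      · obtain ⟨c, d, hd, hfi⟩ := (hf ⟨m, hm⟩).2 h0
        have hpre : (fun j : Fin m => a (Fin.castLE hm.le j)) =
            fun j : Fin m => b (Fin.castLE hm.le j) :=
          funext fun j => ih j.val j.isLt (j.isLt.trans hm)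
        rw [hfi] at h
        rw [map_add, map_add, map_mul, map_mul, MvPolynomial.eval_X, MvPolynomial.eval_X,
          eval_incl, eval_incl, eval_incl, eval_incl] at h
        change (MvPolynomial.eval (fun j : Fin m => a (Fin.castLE hm.le j)) c +
            a ⟨m, hm⟩ * MvPolynomial.eval (fun j : Fin m => a (Fin.castLE hm.le j)) d) = _ at h
        rw [hpre] at h
        exact (hd _).mul_right_cancel (add_left_cancel h)
  exact funext fun i => main i.val i.isLt

theorem inducedMap_bijective [Finite R] {f : VecPoly R n} (hf : f ∈ MT R n) :
    Function.Bijective (inducedMap f) :=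
  Finite.injective_iff_bijective.mp (inducedMap_injective hf)

end Facts

/-- The monoid of all permutations of `R ^ n` induced by the triangular vector-polynomials. -/
noncomputable def inducedMonoid (R : Type*) [CommRing R] (n : ℕ) :
    Submonoid (Equiv.Perm (Fin n → R)) where
  carrier := {σ | ∃ f ∈ MT R n, inducedMap f = ⇑σ}
  one_mem' := ⟨MvPolynomial.X, id_mem_MT, by funext a i; simp [inducedMap]⟩
  mul_mem' := by
    rintro σ τ ⟨f, hf, hσ⟩ ⟨g, hg, hτ⟩
    exact ⟨comp f g, comp_mem_MT hf hg, by rw [inducedMap_comp, hσ, hτ]; rfl⟩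

/-- The group of permutations of `R ^ n` induced by the triangular vector-polynomials over the
finite commutative ring `R`: its elements are exactly the functions `inducedMap f` with
`f ∈ MT R n` (all of which are bijective, by `inducedMap_bijective`). -/
noncomputable def inducedGroup (R : Type*) [CommRing R] [Finite R] (n : ℕ) :
    Subgroup (Equiv.Perm (Fin n → R)) where
  toSubmonoid := inducedMonoid R n
  inv_mem' := by
    intro σ hσ
    have h : σ⁻¹ ∈ Submonoid.powers σ :=
      (isOfFinOrder_of_finite σ).mem_powers_iff_mem_zpowers.mpr
        (inv_mem (Subgroup.mem_zpowers σ))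
    exact (Submonoid.powers_le.mpr hσ) h

end TriangularMonoid

/-!
A triangular permutation acts on each coordinate by polynomial permutations of `R`, once the earlier
coordinates are fixed (`exists_coord_eq_eval`). Filtering the group by the subgroups `stabFirst R n i`
that fix the first `i` coordinates, the successive quotients therefore embed into products of
copies of the group `polyPerm R` of polynomial permutations of `R` (`coordHom`), which is itself the
action on the first coordinate (`firstCoordHom_surjective`). So solvability, and being a `2`-group,
pass from `polyPerm R` to the whole group.

Let `F` be the residue field, with `q` elements, and `𝔪` the maximal ideal. Reduction maps
`polyPerm R` onto the full symmetric group of `F` (`residuePerm_surjective`). The symmetric group on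
`q` points is solvable only for `q ≤ 4` and nilpotent only for `q ≤ 2`, which gives the necessity of
both conditions.

For sufficiency, a permutation in the kernel of the reduction acts on cosets of `𝔪 ^ k` modulo
`𝔪 ^ (k + 1)` as an affine map, whose linear part is multiplication by the derivative. Hence
commutators in the kernel have derivative `1` modulo `𝔪` (`commutator_congrPerm_le_transPerm`), and
permutations with derivative `1` that fix the classes modulo `𝔪 ^ k` commute modulo `𝔪 ^ (k + 1)`
(`commutator_inf_transPerm_le`). As `𝔪` is nilpotent, the kernel is solvable. If `q = 2`, every
derivative is effectively `1` (`polyPerm_le_transPerm`), so squaring moves the kernel down the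
filtration (`sq_mem_congrPerm_pow_succ`), and the group is a `2`-group.

Solvability is verified in the form "every perfect subgroup is trivial", valid for finite groups;
this lets a perfect subgroup be pushed down both filtrations without forming quotients.

If the group is abelian, then `n = 1` by an explicit pair of noncommuting permutations, and `x + 1`
commutes with `u * x` for every unit `u`; so `1` is the only unit, and a local ring with this
property is the field with two elements.
-/

namespace TriangularMonoid

open Polynomial IsLocalRing
open scoped commutatorElement

/-! ### Solvability and perfect subgroups -/

section Perfect

variable {G A : Type*} [Group G] [Group A]

theorem eq_bot_of_commutator_eq_self {H : Subgroup G} [Group.IsSolvable H] (h : ⁅H, H⁆ = H) :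
    H = ⊥ := by
  by_contra hne
  have := (Subgroup.nontrivial_iff_ne_bot H).mpr hne
  refine (Group.IsSolvable.commutator_lt_top_of_nontrivial H).ne ?_
  apply Subgroup.map_injective H.subtype_injective
  rw [Subgroup.map_subtype_commutator, h, ← MonoidHom.range_eq_map, H.range_subtype]

theorem isSolvable_of_forall_perfect_eq_bot [Finite G] (K : Subgroup G)
    (h : ∀ H ≤ K, ⁅H, H⁆ = H → H = ⊥) : Group.IsSolvable K := by
  rw [Group.isSolvable_iff_commutator_lt]
  refine fun H hH => lt_of_le_of_ne (Subgroup.commutator_le_self H) fun heq => hH ?_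
  rw [← Subgroup.map_eq_bot_iff_of_injective H K.subtype_injective]
  refine h _ ?_ ?_
  · simpa [K.range_subtype] using Subgroup.map_le_range K.subtype H
  · rw [← Subgroup.map_commutator, heq]

/-- A homomorphism to a solvable group is trivial on a perfect subgroup. It need only be defined on
a subgroup `K` containing `H`, and only its values need lie in a solvable group `B`. -/
theorem map_eq_one_of_perfect {K H : Subgroup G} (hHK : H ≤ K) (h : ⁅H, H⁆ = H) (f : K →* A)
    {B : Subgroup A} [Group.IsSolvable B] (hf : ∀ x, f x ∈ B) {x : K} (hx : x.1 ∈ H) :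
    f x = 1 := by
  have hperf : ⁅(H.subgroupOf K).map f, (H.subgroupOf K).map f⁆ = (H.subgroupOf K).map f := by
    rw [← Subgroup.map_commutator]
    congr 1
    apply Subgroup.map_injective K.subtype_injective
    rw [Subgroup.map_commutator, Subgroup.map_subgroupOf_eq_of_le hHK, h]
  have hle : (H.subgroupOf K).map f ≤ B := by
    rintro _ ⟨y, -, rfl⟩
    exact hf y
  have : Group.IsSolvable ((H.subgroupOf K).map f) :=
    Group.isSolvable_of_isSolvable_injective (Subgroup.inclusion_injective hle)
  have hmem : f x ∈ (H.subgroupOf K).map f := ⟨x, hx, rfl⟩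
  rwa [eq_bot_of_commutator_eq_self hperf, Subgroup.mem_bot] at hmem

/-- The symmetric group on at most four points is solvable: the derived series of the symmetric
group on four points passes through the alternating group and the Klein four-group. -/
theorem isSolvable_perm_of_card_le_four {X : Type*} [Finite X] (hX : Nat.card X ≤ 4) :
    Group.IsSolvable (Equiv.Perm X) := by
  have hcard : Nat.card (Fin 4) = 4 := by simp
  have hA : Group.IsSolvable (alternatingGroup (Fin 4)) := by
    have hV := alternatingGroup.kleinFour_isKleinFour hcard
    refine ⟨⟨2, ?_⟩⟩
    rw [derivedSeries_succ, derivedSeries_one, ← alternatingGroup.kleinFour_eq_commutator hcard,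
      Subgroup.commutator_eq_bot_iff_le_centralizer]
    intro x hx y hy
    exact congrArg Subtype.val (mul_comm_of_exponent_two hV.exponent_two
      (⟨y, hy⟩ : alternatingGroup.kleinFour (Fin 4)) ⟨x, hx⟩)
  have hS : Group.IsSolvable (Equiv.Perm (Fin 4)) :=
    Group.isSolvable_of_ker_le_range (alternatingGroup (Fin 4)).subtype
      (Equiv.Perm.sign (α := Fin 4)) (by rw [Subgroup.range_subtype]; rfl)
  have := Fintype.ofFinite X
  obtain ⟨e⟩ : Nonempty (X ↪ Fin 4) := by
    rw [Function.Embedding.nonempty_iff_card_le]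
    simpa [Nat.card_eq_fintype_card] using hX
  exact Group.isSolvable_of_isSolvable_injective (Equiv.Perm.viaEmbeddingHom_injective e)

theorem not_isNilpotent_perm {X : Type*} [Finite X] (hX : 3 ≤ Nat.card X) :
    ¬ Group.IsNilpotent (Equiv.Perm X) := by
  intro h
  have := Fintype.ofFinite X
  classical
  rw [Nat.card_eq_fintype_card] at hX
  have : Nontrivial X := Fintype.one_lt_card_iff_nontrivial.mp (by omega)
  have : Nontrivial (Equiv.Perm X) := inferInstance
  obtain ⟨σ, hσ, hσ1⟩ := (Subgroup.bot_or_exists_ne_one _).resolve_left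
    (Group.IsNilpotent.center_ne_bot (G := Equiv.Perm X))
  obtain ⟨x, hx⟩ : ∃ x, σ x ≠ x := by
    by_contra! hall
    exact hσ1 (Equiv.ext hall)
  -- A central permutation moving `x` to `y` commutes with every transposition `(y z)`, so it maps
  -- `x` to `z` as well.
  obtain ⟨z, hz⟩ : ∃ z, z ∉ ({x, σ x} : Finset X) := by
    by_contra! hall
    have := Finset.card_le_card (fun z _ => hall z : Finset.univ ⊆ ({x, σ x} : Finset X))
    have := Finset.card_le_two (a := x) (b := σ x)
    rw [Finset.card_univ] at *
    omega
  simp only [Finset.mem_insert, Finset.mem_singleton, not_or] at hz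
  have hc := congrArg (· x) (Subgroup.mem_center_iff.mp hσ (Equiv.swap (σ x) z))
  simp only [Equiv.Perm.mul_apply, Equiv.swap_apply_left] at hc
  rw [Equiv.swap_apply_of_ne_of_ne hx.symm (Ne.symm hz.1)] at hc
  exact hz.2 hc

end Perfect

/-! ### Permutations of a finite ring induced by polynomials -/

theorem mul_sq_mem_pow_succ {R : Type*} [CommRing R] {I : Ideal R} {k : ℕ} (hk : 1 ≤ k) (c : R)
    {t : R} (ht : t ∈ I ^ k) :
    c * t ^ 2 ∈ I ^ (k + 1) := by
  refine Ideal.mul_mem_left _ _ (Ideal.pow_le_pow_right (show k + 1 ≤ k * 2 by omega) ?_)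
  rw [pow_mul]
  exact Ideal.pow_mem_pow ht 2

section PolyPerm

variable (R : Type*) [CommRing R] [Finite R]

/-- The group of permutations of a finite ring induced by polynomials in one variable. It is closed
under inversion because the inverse of a permutation of a finite set is one of its powers. -/
def polyPerm : Subgroup (Equiv.Perm R) where
  carrier := {σ | ∃ p : R[X], ∀ x, p.eval x = σ x}
  one_mem' := ⟨X, fun x => by simp⟩
  mul_mem' := by
    rintro σ τ ⟨p, hp⟩ ⟨r, hr⟩
    exact ⟨p.comp r, fun x => by rw [eval_comp, hr, hp, Equiv.Perm.mul_apply]⟩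
  inv_mem' := by
    rintro σ ⟨p, hp⟩
    obtain ⟨k, hk⟩ : σ⁻¹ ∈ Submonoid.powers σ :=
      (isOfFinOrder_of_finite σ).mem_powers_iff_mem_zpowers.mpr
        (inv_mem (Subgroup.mem_zpowers σ))
    refine ⟨p.comp^[k] X, fun x => ?_⟩
    have hσ : (fun y => p.eval y) = σ := funext hp
    rw [iterate_comp_eval, hσ, eval_X, ← hk, Equiv.Perm.iterate_eq_pow]

variable {R}

theorem sub_mem_of_mem_polyPerm {σ : Equiv.Perm R} (hσ : σ ∈ polyPerm R) (I : Ideal R) {x y : R}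
    (h : x - y ∈ I) : σ x - σ y ∈ I := by
  obtain ⟨p, hp⟩ := hσ
  rw [← hp, ← hp]
  exact I.mem_of_dvd (sub_dvd_eval_sub x y _) h

/-- The polynomial permutations that fix every residue class modulo `I`. -/
def congrPerm (I : Ideal R) : Subgroup (Equiv.Perm R) where
  carrier := {σ | σ ∈ polyPerm R ∧ ∀ x, σ x - x ∈ I}
  one_mem' := ⟨one_mem _, fun x => by simp⟩
  mul_mem' := by
    rintro σ τ ⟨hσ, hσI⟩ ⟨hτ, hτI⟩
    refine ⟨mul_mem hσ hτ, fun x => ?_⟩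
    simpa using add_mem (hσI (τ x)) (hτI x)
  inv_mem' := by
    rintro σ ⟨hσ, hσI⟩
    refine ⟨inv_mem hσ, fun x => ?_⟩
    simpa using neg_mem (hσI (σ⁻¹ x))

theorem eq_one_of_mem_congrPerm_bot {σ : Equiv.Perm R} (hσ : σ ∈ congrPerm (⊥ : Ideal R)) :
    σ = 1 :=
  Equiv.ext fun x => sub_eq_zero.mp ((Submodule.mem_bot R).mp (hσ.2 x))

/-- Two polynomial permutations that commute modulo `I` have a commutator fixing every residue class
modulo `I`. -/
theorem commutator_mem_congrPerm {σ τ : Equiv.Perm R} (hσ : σ ∈ polyPerm R) (hτ : τ ∈ polyPerm R)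
    {I : Ideal R} (h : ∀ x, σ (τ x) - τ (σ x) ∈ I) : ⁅σ, τ⁆ ∈ congrPerm I := by
  refine ⟨(polyPerm R).mul_mem (mul_mem (mul_mem hσ hτ) (inv_mem hσ)) (inv_mem hτ), fun x => ?_⟩
  simpa [commutatorElement_def] using h (σ⁻¹ (τ⁻¹ x))

variable [IsLocalRing R]

/-- The polynomial permutations that act on each coset of `𝔪 ^ k`, for `k ≥ 1`, as a translation
modulo `𝔪 ^ (k + 1)`, where `𝔪` is the maximal ideal. For `𝔪 ≠ 0` these are the permutations with
derivative `1` modulo `𝔪`; the formulation through values avoids the choice of a polynomial, and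
for `𝔪 = 0` it imposes no condition. -/
def transPerm (R : Type*) [CommRing R] [Finite R] [IsLocalRing R] : Subgroup (Equiv.Perm R) where
  carrier := {σ | σ ∈ polyPerm R ∧ ∀ k ≥ 1, ∀ x, ∀ t ∈ maximalIdeal R ^ k,
    σ (x + t) - σ x - t ∈ maximalIdeal R ^ (k + 1)}
  one_mem' := ⟨one_mem _, fun k _ x t _ => by simp⟩
  mul_mem' := by
    rintro σ τ ⟨hσ, hσk⟩ ⟨hτ, hτk⟩
    refine ⟨mul_mem hσ hτ, fun k hk x t ht => ?_⟩
    have h1 := hτk k hk x t ht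
    have h2 : τ (x + t) - τ x ∈ maximalIdeal R ^ k := by
      simpa using add_mem (Ideal.pow_le_pow_right k.le_succ h1) ht
    have h3 := hσk k hk (τ x) _ h2
    rw [add_sub_cancel] at h3
    simpa using add_mem h3 h1
  inv_mem' := by
    rintro σ ⟨hσ, hσk⟩
    refine ⟨inv_mem hσ, fun k hk x t ht => ?_⟩
    have h1 : σ⁻¹ (x + t) - σ⁻¹ x ∈ maximalIdeal R ^ k :=
      sub_mem_of_mem_polyPerm (inv_mem hσ) _ (by simpa using ht)
    have h2 := neg_mem (hσk k hk (σ⁻¹ x) _ h1)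
    rw [add_sub_cancel] at h2
    simpa using h2

/-- First-order Taylor expansion of a polynomial permutation modulo `𝔪 ^ (k + 1)` on a coset of
`𝔪 ^ k`; modulo `𝔪`, its coefficient depends only on the residue class of the centre. -/
theorem exists_taylor {σ : Equiv.Perm R} (hσ : σ ∈ polyPerm R) :
    ∃ d : R → R, (∀ k ≥ 1, ∀ x, ∀ t ∈ maximalIdeal R ^ k,
        σ (x + t) - σ x - d x * t ∈ maximalIdeal R ^ (k + 1)) ∧
      ∀ x y, x - y ∈ maximalIdeal R → d x - d y ∈ maximalIdeal R := by
  obtain ⟨p, hp⟩ := hσ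
  refine ⟨fun x => p.derivative.eval x, fun k hk x t ht => ?_, fun x y h => ?_⟩
  · obtain ⟨c, hc⟩ := p.binomExpansion x t
    rw [← hp, ← hp, hc]
    convert mul_sq_mem_pow_succ hk c ht using 1
    ring
  · exact Ideal.mem_of_dvd _ (sub_dvd_eval_sub x y _) h

/-- Chain rule for permutations fixing the residue classes modulo `𝔪`: the coefficients multiply
without a shift of the centre. -/
theorem taylor_mul {σ τ : Equiv.Perm R} {d e : R → R} (hτ : τ ∈ congrPerm (maximalIdeal R))
    (hd : ∀ k ≥ 1, ∀ x, ∀ t ∈ maximalIdeal R ^ k,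
      σ (x + t) - σ x - d x * t ∈ maximalIdeal R ^ (k + 1))
    (hd' : ∀ x y, x - y ∈ maximalIdeal R → d x - d y ∈ maximalIdeal R)
    (he : ∀ k ≥ 1, ∀ x, ∀ t ∈ maximalIdeal R ^ k,
      τ (x + t) - τ x - e x * t ∈ maximalIdeal R ^ (k + 1))
    {k : ℕ} (hk : 1 ≤ k) (x : R) {t : R} (ht : t ∈ maximalIdeal R ^ k) :
    σ (τ (x + t)) - σ (τ x) - d x * e x * t ∈ maximalIdeal R ^ (k + 1) := by
  have hs : τ (x + t) - τ x ∈ maximalIdeal R ^ k :=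
    sub_mem_of_mem_polyPerm hτ.1 _ (by simpa using ht)
  have h1 := hd k hk (τ x) _ hs
  have h2 : (d (τ x) - d x) * (τ (x + t) - τ x) ∈ maximalIdeal R ^ (k + 1) := by
    rw [pow_succ']
    exact Ideal.mul_mem_mul (hd' _ _ (hτ.2 x)) hs
  have h3 := Ideal.mul_mem_left _ (d x) (he k hk x t ht)
  rw [add_sub_cancel] at h1
  convert add_mem (add_mem h1 h2) h3 using 1
  ring

/-- By the chain rule, derivatives modulo `𝔪` define a homomorphism from the permutations fixing
the residue classes modulo `𝔪` to a commutative monoid, so commutators have derivative `1`. -/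
theorem commutator_congrPerm_le_transPerm :
    ⁅congrPerm (maximalIdeal R), congrPerm (maximalIdeal R)⁆ ≤ transPerm R := by
  rw [Subgroup.commutator_le]
  intro σ hσ τ hτ
  obtain ⟨d, hd, hd'⟩ := exists_taylor hσ.1
  obtain ⟨e, he, he'⟩ := exists_taylor hτ.1
  have hmem : ⁅σ, τ⁆ ∈ polyPerm R :=
    mul_mem (mul_mem (mul_mem hσ.1 hτ.1) (inv_mem hσ.1)) (inv_mem hτ.1)
  refine ⟨hmem, fun k hk x t ht => ?_⟩
  set ρ := (τ * σ)⁻¹ with hρ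
  have hu : ρ (x + t) - ρ x ∈ maximalIdeal R ^ k :=
    sub_mem_of_mem_polyPerm (inv_mem (mul_mem hτ.1 hσ.1)) _ (by simpa using ht)
  have h1 := taylor_mul hτ hd hd' he hk (ρ x) hu
  have h2 := taylor_mul hσ he he' hd hk (ρ x) hu
  have hcomm : ∀ y, ⁅σ, τ⁆ y = σ (τ (ρ y)) := fun y => by
    simp [hρ, commutatorElement_def]
  have hinv : ∀ y, τ (σ (ρ y)) = y := fun y => by simp [hρ]
  rw [add_sub_cancel] at h1 h2
  rw [hinv, hinv] at h2
  rw [hcomm, hcomm]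
  convert sub_mem h1 h2 using 1
  ring

/-- Modulo `𝔪 ^ (k + 1)`, both compositions of `σ` and `τ` add the displacements of `σ` and `τ`. -/
theorem commutator_inf_transPerm_le {k : ℕ} (hk : 1 ≤ k) :
    ⁅congrPerm (maximalIdeal R ^ k) ⊓ transPerm R, congrPerm (maximalIdeal R ^ k) ⊓ transPerm R⁆ ≤
      congrPerm (maximalIdeal R ^ (k + 1)) := by
  rw [Subgroup.commutator_le]
  rintro σ ⟨hσ, hσt⟩ τ ⟨hτ, hτt⟩
  refine commutator_mem_congrPerm hσ.1 hτ.1 fun x => ?_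
  have h1 := hσt.2 k hk x _ (hτ.2 x)
  have h2 := hτt.2 k hk x _ (hσ.2 x)
  rw [add_sub_cancel] at h1 h2
  convert sub_mem h1 h2 using 1
  ring

theorem exists_maximalIdeal_pow_eq_bot (R : Type*) [CommRing R] [Finite R] [IsLocalRing R] :
    ∃ m, maximalIdeal R ^ m = ⊥ := by
  have : IsArtinianRing R := inferInstance
  have h := IsArtinianRing.isNilpotent_jacobson_bot (R := R)
  rwa [IsLocalRing.jacobson_eq_maximalIdeal ⊥ bot_ne_top] at h

end PolyPerm

/-! ### Reduction to the residue field -/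

section Residue

theorem residue_eq_residue_iff {R : Type*} [CommRing R] [IsLocalRing R] {x y : R} :
    residue R x = residue R y ↔ x - y ∈ maximalIdeal R := by
  rw [← sub_eq_zero, ← map_sub, residue_eq_zero_iff]

variable {R : Type*} [CommRing R] [Finite R] [IsLocalRing R]

theorem residue_apply_congr {σ : Equiv.Perm R} (hσ : σ ∈ polyPerm R) {x y : R}
    (h : residue R x = residue R y) : residue R (σ x) = residue R (σ y) :=
  residue_eq_residue_iff.mpr (sub_mem_of_mem_polyPerm hσ _ (residue_eq_residue_iff.mp h))

variable (R) in
/-- The permutation of the residue field induced by a polynomial permutation. -/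
noncomputable def residuePerm : polyPerm R →* Equiv.Perm (ResidueField R) :=
  MonoidHom.toHomPerm
    { toFun := fun σ z => residue R (σ.1 (Function.surjInv residue_surjective z))
      map_one' := funext fun z => Function.surjInv_eq residue_surjective z
      map_mul' := fun σ _ => funext fun _ =>
        residue_apply_congr σ.2 (Function.surjInv_eq residue_surjective _).symm }

theorem residuePerm_residue (σ : polyPerm R) (x : R) :
    residuePerm R σ (residue R x) = residue R (σ.1 x) :=
  residue_apply_congr σ.2 (Function.surjInv_eq residue_surjective _)

theorem residuePerm_eq_one_iff {σ : polyPerm R} :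
    residuePerm R σ = 1 ↔ σ.1 ∈ congrPerm (maximalIdeal R) := by
  refine ⟨fun h => ⟨σ.2, fun x => ?_⟩, fun h => Equiv.ext fun z => ?_⟩
  · rw [← residue_eq_residue_iff, ← residuePerm_residue, h, Equiv.Perm.one_apply]
  · obtain ⟨x, rfl⟩ := residue_surjective z
    rw [residuePerm_residue, Equiv.Perm.one_apply, residue_eq_residue_iff]
    exact h.2 x

/-- Over a finite field with `q` elements, subtracting a multiple of `X ^ q - X` adjusts the
derivative of a polynomial without changing its values. -/
theorem exists_eval_eq_and_derivative_eq_one {F : Type*} [Field F] [Finite F] (e : F → F) :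
    ∃ f : F[X], (∀ z, f.eval z = e z) ∧ ∀ z, f.derivative.eval z = 1 := by
  classical
  have := Fintype.ofFinite F
  set g := Lagrange.interpolate Finset.univ id e
  refine ⟨g + (X ^ Fintype.card F - X) * (derivative g - 1), fun z => ?_, fun z => ?_⟩
  · have h : g.eval z = e z :=
      Lagrange.eval_interpolate_at_node (v := id) e (Function.injective_id.injOn)
        (Finset.mem_univ z)
    simp [h, FiniteField.pow_card]
  · simp [FiniteField.pow_card, derivative_X_pow]

/-- Every permutation of the residue field lifts to a polynomial permutation: a polynomial that
permutes the residue field and has unit derivative is injective on the ring. -/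
theorem residuePerm_surjective : Function.Surjective (residuePerm R) := by
  intro e
  have : Finite (ResidueField R) := Finite.of_surjective _ residue_surjective
  obtain ⟨f, hf, hf'⟩ := exists_eval_eq_and_derivative_eq_one e
  obtain ⟨p, rfl⟩ := Polynomial.map_surjective (residue R) residue_surjective f
  have hp : ∀ x, residue R (p.eval x) = e (residue R x) := fun x => by
    rw [← hf, eval_map_apply]
  have hinj : Function.Injective fun x => p.eval x := by
    intro x y hxy
    have hmem : y - x ∈ maximalIdeal R := by
      rw [← residue_eq_residue_iff]
      apply e.injective
      rw [← hp, ← hp]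
      exact congrArg _ hxy.symm
    obtain ⟨c, hc⟩ := p.binomExpansion x (y - x)
    have hunit : IsUnit (p.derivative.eval x + c * (y - x)) := by
      rw [← residue_ne_zero_iff_isUnit, map_add, map_mul, (residue_eq_zero_iff _).mpr hmem,
        ← eval_map_apply, ← derivative_map, hf']
      simp
    rw [add_sub_cancel] at hc
    have hzero : (p.derivative.eval x + c * (y - x)) * (y - x) = 0 := by
      have hxy' : p.eval x = p.eval y := hxy
      linear_combination -hxy' - hc
    exact (sub_eq_zero.mp (hunit.mul_right_eq_zero.mp hzero)).symm
  refine ⟨⟨Equiv.ofBijective _ (Finite.injective_iff_bijective.mp hinj), p, fun x => rfl⟩,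
    Equiv.ext fun z => ?_⟩
  obtain ⟨x, rfl⟩ := residue_surjective z
  rw [residuePerm_residue, ← hp]
  rfl

/-- A perfect group of polynomial permutations is trivial: it acts trivially on the residue field,
its elements have derivative `1` modulo the maximal ideal `𝔪`, and then it fixes all residue classes
modulo ever higher powers of `𝔪`. -/
theorem isSolvable_polyPerm (h : Nat.card (ResidueField R) ≤ 4) :
    Group.IsSolvable (polyPerm R) := by
  have : Finite (ResidueField R) := Finite.of_surjective _ residue_surjective
  have hS := isSolvable_perm_of_card_le_four h
  refine isSolvable_of_forall_perfect_eq_bot _ fun H hH hperf => ?_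
  have h1 : H ≤ congrPerm (maximalIdeal R) := fun σ hσ =>
    residuePerm_eq_one_iff.mp (map_eq_one_of_perfect hH hperf (residuePerm R) (B := ⊤)
      (fun _ => Subgroup.mem_top _) (x := ⟨σ, hH hσ⟩) hσ)
  have h2 : H ≤ transPerm R := by
    rw [← hperf]
    exact (Subgroup.commutator_mono h1 h1).trans commutator_congrPerm_le_transPerm
  have h3 : ∀ k ≥ 1, H ≤ congrPerm (maximalIdeal R ^ k) := by
    intro k hk
    induction k, hk using Nat.le_induction with
    | base => rwa [pow_one]
    | succ k hk ih =>
      rw [← hperf]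
      exact (Subgroup.commutator_mono (le_inf ih h2) (le_inf ih h2)).trans
        (commutator_inf_transPerm_le hk)
  obtain ⟨m, hm⟩ := exists_maximalIdeal_pow_eq_bot R
  rw [eq_bot_iff]
  intro σ hσ
  refine Subgroup.mem_bot.mpr (eq_one_of_mem_congrPerm_bot ?_)
  rw [← le_bot_iff.mp ((Ideal.pow_le_pow_right m.le_succ).trans hm.le)]
  exact h3 (m + 1) (Nat.le_add_left 1 m) hσ

/-- Over a residue field with two elements the derivatives of a polynomial permutation are `1`
modulo `𝔪` wherever they matter: a nonunit derivative would contract cosets of `𝔪 ^ k`, which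
the inverse permutation forbids unless `𝔪 ^ k = 𝔪 ^ (k + 1)`. -/
theorem polyPerm_le_transPerm (h : Nat.card (ResidueField R) = 2) : polyPerm R ≤ transPerm R := by
  intro σ hσ
  refine ⟨hσ, fun k hk x t ht => ?_⟩
  obtain ⟨d, hd, -⟩ := exists_taylor hσ
  have h1 := hd k hk x t ht
  have hcase : d x ∈ maximalIdeal R ∨ d x - 1 ∈ maximalIdeal R := by
    have : Finite (ResidueField R) := Finite.of_surjective _ residue_surjective
    have := Fintype.ofFinite (ResidueField R)
    have h2 := FiniteField.pow_card (residue R (d x))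
    rw [← Nat.card_eq_fintype_card, h] at h2
    rw [← residue_eq_residue_iff, ← residue_eq_zero_iff, map_one]
    rcases eq_or_ne (residue R (d x)) 0 with h0 | h0
    · exact Or.inl h0
    · exact Or.inr (mul_left_cancel₀ h0 (by rw [← pow_two, h2, mul_one]))
  rcases hcase with hx | hx
  · have h2 : d x * t ∈ maximalIdeal R ^ (k + 1) := by
      rw [pow_succ']
      exact Ideal.mul_mem_mul hx ht
    have h3 : σ (x + t) - σ x ∈ maximalIdeal R ^ (k + 1) := by simpa using add_mem h1 h2
    have h4 := sub_mem_of_mem_polyPerm (inv_mem hσ) _ h3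
    rw [Equiv.Perm.inv_def, Equiv.symm_apply_apply, Equiv.symm_apply_apply,
      add_sub_cancel_left] at h4
    exact sub_mem h3 h4
  · have h2 : (d x - 1) * t ∈ maximalIdeal R ^ (k + 1) := by
      rw [pow_succ']
      exact Ideal.mul_mem_mul hx ht
    convert add_mem h1 h2 using 1
    ring

theorem sq_mem_congrPerm_pow_succ (h : Nat.card (ResidueField R) = 2) {k : ℕ} (hk : 1 ≤ k)
    {σ : Equiv.Perm R} (hσ : σ ∈ congrPerm (maximalIdeal R ^ k)) :
    σ ^ 2 ∈ congrPerm (maximalIdeal R ^ (k + 1)) := by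
  refine ⟨pow_mem hσ.1 2, fun x => ?_⟩
  have htwo : (2 : R) ∈ maximalIdeal R := by
    have : Finite (ResidueField R) := Finite.of_surjective _ residue_surjective
    have := Fintype.ofFinite (ResidueField R)
    have h0 := FiniteField.cast_card_eq_zero (ResidueField R)
    rw [← Nat.card_eq_fintype_card, h] at h0
    rw [← residue_eq_zero_iff, map_ofNat]
    exact_mod_cast h0
  have h1 := (polyPerm_le_transPerm h hσ.1).2 k hk x _ (hσ.2 x)
  have h2 : 2 * (σ x - x) ∈ maximalIdeal R ^ (k + 1) := by
    rw [pow_succ']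
    exact Ideal.mul_mem_mul htwo (hσ.2 x)
  rw [add_sub_cancel] at h1
  rw [pow_two, Equiv.Perm.mul_apply]
  convert add_mem h1 h2 using 1
  ring

theorem isPGroup_polyPerm (h : Nat.card (ResidueField R) = 2) : IsPGroup 2 (polyPerm R) := by
  have : Finite (ResidueField R) := Finite.of_surjective _ residue_surjective
  rintro ⟨σ, hσ⟩
  have h1 : ∀ k ≥ 1, σ ^ 2 ^ k ∈ congrPerm (maximalIdeal R ^ k) := by
    intro k hk
    induction k, hk using Nat.le_induction with
    | base =>
      have hcard : Nat.card (Equiv.Perm (ResidueField R)) = 2 := by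
        rw [Nat.card_perm, h]
        rfl
      have h2 : residuePerm R (⟨σ, hσ⟩ ^ 2) = 1 := by
        rw [map_pow, ← hcard, pow_card_eq_one']
      simpa using residuePerm_eq_one_iff.mp h2
    | succ k hk ih =>
      rw [pow_succ 2, pow_mul]
      exact sq_mem_congrPerm_pow_succ h hk ih
  obtain ⟨m, hm⟩ := exists_maximalIdeal_pow_eq_bot R
  refine ⟨m + 1, Subtype.ext (eq_one_of_mem_congrPerm_bot ?_)⟩
  rw [← le_bot_iff.mp ((Ideal.pow_le_pow_right m.le_succ).trans hm.le)]
  exact h1 (m + 1) (Nat.le_add_left 1 m)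

end Residue

/-! ### Triangular permutations, coordinate by coordinate -/

section Triangular

variable {R : Type*} [CommRing R] [Finite R] {n : ℕ}

/-- Each coordinate of a triangular permutation is a polynomial in the same coordinate of the
argument, whose coefficients depend on the earlier coordinates only. -/
theorem exists_coord_eq_eval {σ : Equiv.Perm (Fin n → R)} (hσ : σ ∈ inducedGroup R n) (i : Fin n) :
    ∃ F : (Fin i.val → R) → Polynomial R,
      ∀ a, σ a i = (F fun j => a (Fin.castLE i.isLt.le j)).eval (a i) := by
  obtain ⟨f, hf, hfσ⟩ := hσ
  by_cases hi : i.val = 0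
  · obtain ⟨p, -, hp⟩ := (hf i).1 hi
    refine ⟨fun _ => p, fun a => ?_⟩
    rw [← hfσ, inducedMap, hp, ← MvPolynomial.coe_aeval_eq_eval, RingHom.coe_coe,
      ← Polynomial.aeval_algHom_apply, MvPolynomial.aeval_X, Polynomial.coe_aeval_eq_eval]
  · obtain ⟨c, d, -, hcd⟩ := (hf i).2 hi
    refine ⟨fun b => Polynomial.C (MvPolynomial.eval b c) +
      Polynomial.X * Polynomial.C (MvPolynomial.eval b d), fun a => ?_⟩
    rw [← hfσ, inducedMap, hcd]
    simp only [map_add, map_mul, eval_incl, MvPolynomial.eval_X, Polynomial.eval_add,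
      Polynomial.eval_mul, Polynomial.eval_C, Polynomial.eval_X]

theorem coord_congr {σ : Equiv.Perm (Fin n → R)} (hσ : σ ∈ inducedGroup R n) {i : Fin n}
    {a b : Fin n → R} (h : ∀ j ≤ i, a j = b j) : σ a i = σ b i := by
  obtain ⟨F, hF⟩ := exists_coord_eq_eval hσ i
  rw [hF, hF, h i le_rfl]
  congr 3
  funext j
  exact h _ j.isLt.le

variable (R n) in
/-- The triangular permutations that fix the first `i` coordinates of every vector. -/
noncomputable def stabFirst (i : ℕ) : Subgroup (Equiv.Perm (Fin n → R)) where
  carrier := {σ | σ ∈ inducedGroup R n ∧ ∀ a, ∀ j : Fin n, j.val < i → σ a j = a j}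
  one_mem' := ⟨one_mem _, fun a j _ => rfl⟩
  mul_mem' := by
    rintro σ τ ⟨hσ, hσi⟩ ⟨hτ, hτi⟩
    exact ⟨mul_mem hσ hτ, fun a j hj => by rw [Equiv.Perm.mul_apply, hσi _ j hj, hτi _ j hj]⟩
  inv_mem' := by
    rintro σ ⟨hσ, hσi⟩
    refine ⟨inv_mem hσ, fun a j hj => ?_⟩
    rw [← hσi (σ⁻¹ a) j hj, Equiv.Perm.inv_def, Equiv.apply_symm_apply]

theorem mem_stabFirst_zero {σ : Equiv.Perm (Fin n → R)} :
    σ ∈ stabFirst R n 0 ↔ σ ∈ inducedGroup R n :=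
  ⟨fun h => h.1, fun h => ⟨h, fun _ j hj => absurd hj j.val.not_lt_zero⟩⟩

theorem eq_one_of_mem_stabFirst {σ : Equiv.Perm (Fin n → R)} (h : σ ∈ stabFirst R n n) : σ = 1 :=
  Equiv.ext fun a => funext fun j => h.2 a j j.isLt

/-- The action of the triangular permutations fixing the coordinates before the `i`-th on the
`i`-th coordinate, the earlier coordinates being those of `a`; the later coordinates of `a` do not
matter. -/
noncomputable def coordHom (i : Fin n) (a : Fin n → R) : stabFirst R n i →* Equiv.Perm R :=
  MonoidHom.toHomPerm
    { toFun := fun σ x => σ.1 (Function.update a i x) i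
      map_one' := by
        funext x
        exact Function.update_self i x a
      map_mul' := fun σ τ => funext fun x => by
        refine coord_congr σ.2.1 fun j hj => ?_
        rcases hj.lt_or_eq with hj | rfl
        · rw [τ.2.2 _ j hj, Function.update_of_ne hj.ne, Function.update_of_ne hj.ne]
        · rw [Function.update_self] }

theorem coordHom_apply (i : Fin n) (a : Fin n → R) (σ : stabFirst R n i) (x : R) :
    coordHom i a σ x = σ.1 (Function.update a i x) i :=
  rfl

theorem coordHom_mem_polyPerm (i : Fin n) (a : Fin n → R) (σ : stabFirst R n i) :
    coordHom i a σ ∈ polyPerm R := by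
  obtain ⟨F, hF⟩ := exists_coord_eq_eval σ.2.1 i
  refine ⟨F fun j => a (Fin.castLE i.isLt.le j), fun x => ?_⟩
  rw [coordHom_apply, hF, Function.update_self]
  congr 2
  funext j
  have hne : Fin.castLE i.isLt.le j ≠ i := fun h => j.isLt.ne (congrArg Fin.val h)
  exact (Function.update_of_ne hne x a).symm

theorem mem_stabFirst_succ {i : Fin n} {σ : stabFirst R n i} (h : ∀ a, coordHom i a σ = 1) :
    σ.1 ∈ stabFirst R n (i + 1) := by
  refine ⟨σ.2.1, fun a j hj => ?_⟩
  rcases (Nat.lt_succ_iff.mp hj).lt_or_eq with hj | hj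
  · exact σ.2.2 a j hj
  · obtain rfl := Fin.ext hj
    have := congrArg (· (a j)) (h a)
    simpa only [coordHom_apply, Function.update_eq_self, Equiv.Perm.one_apply] using this

theorem isSolvable_inducedGroup (n : ℕ) [Group.IsSolvable (polyPerm R)] :
    Group.IsSolvable (inducedGroup R n) := by
  refine isSolvable_of_forall_perfect_eq_bot _ fun H hH hperf => ?_
  have h : ∀ i ≤ n, H ≤ stabFirst R n i := by
    intro i
    induction i with
    | zero => exact fun _ σ hσ => mem_stabFirst_zero.mpr (hH hσ)
    | succ i ih =>
      intro hi σ hσ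
      have hle : H ≤ stabFirst R n (⟨i, hi⟩ : Fin n) := ih (Nat.le_of_succ_le hi)
      exact mem_stabFirst_succ (σ := ⟨σ, hle hσ⟩) fun a =>
        map_eq_one_of_perfect hle hperf _ (coordHom_mem_polyPerm _ a) hσ
  exact eq_bot_iff.mpr fun σ hσ => Subgroup.mem_bot.mpr (eq_one_of_mem_stabFirst (h n le_rfl hσ))

theorem isPGroup_inducedGroup (n : ℕ) {p : ℕ} [Fact p.Prime] (h : IsPGroup p (polyPerm R)) :
    IsPGroup p (inducedGroup R n) := by
  obtain ⟨k, hk⟩ := IsPGroup.iff_card.mp h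
  rintro ⟨σ, hσ⟩
  have key : ∀ i ≤ n, σ ^ p ^ (k * i) ∈ stabFirst R n i := by
    intro i
    induction i with
    | zero => exact fun _ => mem_stabFirst_zero.mpr (pow_mem hσ _)
    | succ i ih =>
      intro hi
      have hmem : σ ^ p ^ (k * i) ∈ stabFirst R n (⟨i, hi⟩ : Fin n) := ih (Nat.le_of_succ_le hi)
      rw [mul_add, mul_one, pow_add p, pow_mul]
      refine mem_stabFirst_succ (i := ⟨i, hi⟩) (σ := ⟨_, hmem⟩ ^ p ^ k) fun a => ?_
      have := pow_card_eq_one' (x := (⟨_, coordHom_mem_polyPerm _ a ⟨_, hmem⟩⟩ : polyPerm R))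
      rw [hk] at this
      rw [map_pow]
      exact congrArg Subtype.val this
  exact ⟨k * n, Subtype.ext (eq_one_of_mem_stabFirst (key n le_rfl))⟩

/-- A polynomial permutation acting on the first coordinate alone is triangular. -/
theorem exists_mem_inducedGroup {σ : Equiv.Perm R} (hσ : σ ∈ polyPerm R) (hn : 0 < n) :
    ∃ τ ∈ inducedGroup R n, ∀ a, τ a = Function.update a ⟨0, hn⟩ (σ (a ⟨0, hn⟩)) := by
  obtain ⟨p, hp⟩ := hσ
  let f : VecPoly R n := Function.update MvPolynomial.X ⟨0, hn⟩
    (Polynomial.aeval (MvPolynomial.X ⟨0, hn⟩) p)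
  have hf : f ∈ MT R n := by
    refine fun i => ⟨fun hi => ⟨p, ?_, ?_⟩, fun hi => ⟨0, 1, fun a => by simp, ?_⟩⟩
    · rw [IsPermutationPolynomial, funext hp]
      exact σ.bijective
    · obtain rfl : i = ⟨0, hn⟩ := Fin.ext hi
      exact Function.update_self _ _ _
    · have hne : i ≠ ⟨0, hn⟩ := fun h => hi (congrArg Fin.val h)
      simp [f, Function.update_of_ne hne]
  refine ⟨Equiv.ofBijective _ (inducedMap_bijective hf), ⟨f, hf, rfl⟩, fun a => funext fun i => ?_⟩
  change MvPolynomial.eval a (f i) = _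
  rcases eq_or_ne i ⟨0, hn⟩ with rfl | hne
  · rw [Function.update_self, ← hp]
    simp only [f, Function.update_self]
    rw [← MvPolynomial.coe_aeval_eq_eval, RingHom.coe_coe,
      ← Polynomial.aeval_algHom_apply, MvPolynomial.aeval_X, Polynomial.coe_aeval_eq_eval]
  · simp [f, Function.update_of_ne hne]

/-- The action of triangular permutations on the first coordinate. -/
noncomputable def firstCoordHom (hn : 0 < n) : inducedGroup R n →* polyPerm R :=
  ((coordHom ⟨0, hn⟩ 0).codRestrict (polyPerm R) (coordHom_mem_polyPerm _ 0)).comp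
    (Subgroup.inclusion fun _ h => mem_stabFirst_zero.mpr h)

theorem firstCoordHom_surjective (hn : 0 < n) :
    Function.Surjective (firstCoordHom (R := R) hn) := by
  rintro ⟨σ, hσ⟩
  obtain ⟨τ, hτ, hτσ⟩ := exists_mem_inducedGroup hσ hn
  refine ⟨⟨τ, hτ⟩, Subtype.ext (Equiv.ext fun x => ?_)⟩
  change τ (Function.update 0 ⟨0, hn⟩ x) ⟨0, hn⟩ = σ x
  rw [hτσ, Function.update_self, Function.update_self]

/-- Adding the first coordinate to the second one is triangular. -/
theorem exists_transvection_mem_inducedGroup (hn : 1 < n) :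
    ∃ τ ∈ inducedGroup R n, ∀ a, τ a = Function.update a ⟨1, hn⟩
      (a ⟨0, Nat.zero_lt_of_lt hn⟩ + a ⟨1, hn⟩) := by
  let f : VecPoly R n := Function.update MvPolynomial.X ⟨1, hn⟩
    (MvPolynomial.X ⟨0, Nat.zero_lt_of_lt hn⟩ + MvPolynomial.X ⟨1, hn⟩)
  have hf : f ∈ MT R n := by
    intro i
    rcases eq_or_ne i ⟨1, hn⟩ with rfl | hne
    · refine ⟨fun hi => absurd hi one_ne_zero, fun _ =>
        ⟨MvPolynomial.X ⟨0, one_pos⟩, 1, fun a => by simp, ?_⟩⟩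
      rw [map_one, mul_one]
      simp only [f, Function.update_self, incl, MvPolynomial.rename_X]
      rfl
    · simpa only [f, Function.update_of_ne hne] using id_mem_MT (R := R) i
  refine ⟨Equiv.ofBijective _ (inducedMap_bijective hf), ⟨f, hf, rfl⟩, fun a => funext fun i => ?_⟩
  change MvPolynomial.eval a (f i) = _
  rcases eq_or_ne i ⟨1, hn⟩ with rfl | hne
  · simp [f]
  · simp [f, Function.update_of_ne hne]

end Triangular

/-! ### Commutativity -/

section Commutative

variable {R : Type*} [CommRing R] [Finite R]

theorem add_one_mem_polyPerm : Equiv.addRight (1 : R) ∈ polyPerm R :=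
  ⟨Polynomial.X + 1, fun x => by simp⟩

/-- A ring whose polynomial permutations commute has no unit besides `1`, because `x ↦ x + 1`
commutes with multiplication by a unit only if the unit is `1`. -/
theorem unit_eq_one_of_commute (h : ∀ σ ∈ polyPerm R, ∀ τ ∈ polyPerm R, σ * τ = τ * σ)
    {u : R} (hu : IsUnit u) : u = 1 := by
  obtain ⟨u, rfl⟩ := hu
  have hmem : Units.mulLeft u ∈ polyPerm R :=
    ⟨Polynomial.C u.1 * Polynomial.X, fun x => by simp⟩
  have := congrArg (· 0) (h _ hmem _ add_one_mem_polyPerm)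
  simpa using this

theorem nonempty_ringEquiv_zmod_two [IsLocalRing R] (h : ∀ u : R, IsUnit u → u = 1) :
    Nonempty (R ≃+* ZMod 2) := by
  classical
  have hR : ∀ x : R, x = 0 ∨ x = 1 := by
    intro x
    rcases IsLocalRing.isUnit_or_isUnit_one_sub_self x with hx | hx
    · exact Or.inr (h x hx)
    · exact Or.inl (by simpa using h _ hx)
  have := Fintype.ofFinite R
  have hcard : Fintype.card R = 2 := by
    rw [← Finset.card_univ, Finset.card_eq_two]
    exact ⟨0, 1, zero_ne_one, by ext x; simpa using hR x⟩
  exact ⟨(ZMod.ringEquivOfPrime R Nat.prime_two hcard).symm⟩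

theorem perm_mul_comm_of_card_eq_two {X : Type*} (h : Nat.card X = 2) (σ τ : Equiv.Perm X) :
    σ * τ = τ * σ := by
  have hcard : Nat.card (Equiv.Perm X) = 2 := by
    have := Nat.finite_of_card_ne_zero (h.trans_ne two_ne_zero)
    rw [Nat.card_perm, h]
    rfl
  have : Fact (Nat.Prime 2) := ⟨Nat.prime_two⟩
  have := isCyclic_of_prime_card hcard
  exact mul_comm' σ τ

/-- In at least two variables, `x₁ ↦ x₁ + 1` does not commute with `x₂ ↦ x₁ + x₂`. -/
theorem not_commute_of_one_lt [Nontrivial R] {n : ℕ} (hn : 1 < n) :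
    ¬ IsMulCommutative (inducedGroup R n) := by
  intro h
  obtain ⟨σ, hσ, hσ'⟩ := exists_mem_inducedGroup (R := R) add_one_mem_polyPerm
    (Nat.zero_lt_of_lt hn)
  obtain ⟨τ, hτ, hτ'⟩ := exists_transvection_mem_inducedGroup (R := R) hn
  have hcomm := congrArg Subtype.val (mul_comm' (⟨σ, hσ⟩ : inducedGroup R n) ⟨τ, hτ⟩)
  have := congrArg (fun ρ : Equiv.Perm (Fin n → R) => ρ 0 ⟨1, hn⟩) hcomm
  simp [hσ', hτ'] at this

end Commutative

end TriangularMonoid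

open TriangularMonoid

theorem mainTheorem6 (R : Type*) [CommRing R] [IsLocalRing R] [Finite R]
    (q : ℕ) (hq : Nat.card (IsLocalRing.ResidueField R) = q) (n : ℕ) (hn : 1 ≤ n) :
    (Group.IsSolvable (TriangularMonoid.inducedGroup R n) ↔ q ≤ 4) ∧
    (Group.IsNilpotent (TriangularMonoid.inducedGroup R n) ↔ q = 2) ∧
    (IsMulCommutative (TriangularMonoid.inducedGroup R n) ↔
      n = 1 ∧ Nonempty (R ≃+* ZMod 2)) := by
  subst hq
  have : Finite (IsLocalRing.ResidueField R) :=
    Finite.of_surjective _ IsLocalRing.residue_surjective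
  have hsurj : Function.Surjective ((residuePerm R).comp (firstCoordHom (n := n) hn)) :=
    residuePerm_surjective.comp (firstCoordHom_surjective hn)
  refine ⟨⟨fun h => ?_, fun h => ?_⟩, ⟨fun h => ?_, fun h => ?_⟩, ⟨fun h => ?_, ?_⟩⟩
  · by_contra! hlt
    refine Equiv.Perm.not_isSolvable (IsLocalRing.ResidueField R) ?_
      (Group.isSolvable_of_surjective hsurj)
    rw [← Nat.cast_card]
    exact_mod_cast hlt
  · have := isSolvable_polyPerm h
    exact isSolvable_inducedGroup n
  · have hnil := Group.nilpotent_of_surjective _ hsurj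
    have h2 := Finite.one_lt_card (α := IsLocalRing.ResidueField R)
    have h3 := mt not_isNilpotent_perm (not_not.mpr hnil)
    omega
  · have : Fact (Nat.Prime 2) := ⟨Nat.prime_two⟩
    exact (isPGroup_inducedGroup n (isPGroup_polyPerm h)).isNilpotent
  · obtain rfl : n = 1 := le_antisymm (not_lt.mp fun h1 => not_commute_of_one_lt h1 h) hn
    refine ⟨rfl, nonempty_ringEquiv_zmod_two fun u hu => unit_eq_one_of_commute ?_ hu⟩
    intro σ hσ τ hτ
    obtain ⟨σ', hσ'⟩ := firstCoordHom_surjective hn ⟨σ, hσ⟩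
    obtain ⟨τ', hτ'⟩ := firstCoordHom_surjective hn ⟨τ, hτ⟩
    have := congrArg (firstCoordHom hn) (mul_comm' σ' τ')
    rw [map_mul, map_mul, hσ', hτ'] at this
    exact congrArg Subtype.val this
  · rintro ⟨rfl, ⟨e⟩⟩
    have hcard : Nat.card (Fin 1 → R) = 2 := by
      rw [Nat.card_fun, Nat.card_congr e.toEquiv]
      simp
    exact isMulCommutative_iff.mpr fun σ τ => Subtype.ext (perm_mul_comm_of_card_eq_two hcard _ _)
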